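/- **Setting.** Let $\mathbb F_q$ be a finite field, let $N,K,m\ge 1$ and $S,T,A,D_2\ge 0$ be integers. A Lagrange coded computing scheme with $N$ workers and $m$ points per worker consists of distinct evaluation points $\alpha_{i,j}\in\mathbb F_q$ ($i<N$, $j<m$) and distinct interpolation points $\beta_1,\dots,\beta_{m(K+T)}\in\mathbb F_q$, different from all $\alpha_{i,j}$. Given data matrices $X_1,\dots,X_{mK}$ over $\mathbb F_q$ and independent uniformly random matrices $Z_{mK+1},\dots,Z_{m(K+T)}$, let $u$ be the matrix-valued polynomial of degree less than $m(K+T)$ with $u(\beta_j)=X_j$ for $j\le mK$ and $u(\beta_j)=Z_j$ for $j>mK$. Worker $i$ receives the shares $u(\alpha_{i,0}),\dots,u(\alpha_{i,m-1})$ and is to return the values of $g$ at them, where $g$ is a matrix-valued polynomial function whose entries have total degree at most $D_2$. For $m=1$ the scheme is *LCC*. If $\alpha_{i,j}=\alpha^{mi+j}$ for a primitive element $\alpha$ of $\mathbb F_q$, it is *FLCC* with folding parameter $m$. The scheme is *$S$-resilient and $A$-secure with $t$ extra evaluations* if for every such $g$ the master recovers $g(X_1),\dots,g(X_{mK})$,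 entry by entry, with certainty, for all data and masks, whenever at most $S$ workers do not answer and at most $A$ workers behave arbitrarily; here, for each entry of the output, the master may, after it has received the answers, choose $t$ points of $\mathbb F_q$ and compute the true values of that entry of $f=g\circ u$ there. It is *$T$-private* if the joint law of the shares of any at most $T$ workers does not depend on the data. For $N>S$ put $$r=\frac{(K+T-\frac1m)D_2+1}{N-S},\qquad a(s)=\frac{s}{s+1}\Bigl(1-\frac{mr}{m-s+1}\Bigr),$$ and let $s^*$ be any maximizer of $a$ over $\{1,\dots,m\}$. With $\tilde s=\frac{\sqrt{m(m+1)(m(1-r)+2)r}-(m+1)}{mr-1}$ (for $mr\neq1$) write (∗) for the assertion: if $mr\ne1$, then $s^*\in\{\lceil\tilde s\rceil-1,\lceil\tilde s\rceil\}$. **Statement.** (1) There is an absolute constant $C>0$ such that the following holds for all $0<\varepsilon<1$ and all $N,S,K,T,D_2$ with $K\ge1$ for which $$A=\bigl\lfloor(1-\varepsilon)(N-S)-(K+T)D_2-1\bigr\rfloor$$ is nonnegative (so $N>S$). (a) There is a folding parameter $1\le m\le C/\varepsilon^2$ such that $s^*\le C/\varepsilon$, (∗) holds, and every FLCC with this $m$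 (over any finite field) is $T$-private, and is $S$-resilient and $A$-secure with $s^*-1$ extra evaluations. (b) For every integer $m\ge1/\varepsilon^2$ (for instance $m=\lceil1/\varepsilon^2\rceil$, which depends on $\varepsilon$ only), (∗) holds, every FLCC with this $m$ is $T$-private, and is $S$-resilient and $A$-secure with $s^*-1$ extra evaluations, and $s^*\le C\sqrt{m/r}$. Thus $m=\lceil1/\varepsilon^2\rceil$ gives $s^*=O(1/\varepsilon)$ with a constant that depends only on a positive lower bound for $r$. (2) Marginal cost. For $0<\varepsilon<1$ and integers $A\ge0$, the condition $A\le\lfloor(1-\varepsilon)(N-S)-(K+T)D_2-1\rfloor$ is equivalent to $$N\ \ge\ S+\frac{A+(K+T)D_2+1}{1-\varepsilon},$$ so in (1) each further adversary costs $\frac1{1-\varepsilon}$ further workers, about one, as each straggler costs one. In contrast, for $K,D_2\ge1$, an LCC scheme over a finite field (no extra evaluations) is $S$-resilient, $A$-secure and $T$-private for all $g$ of degree at most $D_2$ if and only if $N\ge(K+T-1)D_2+S+2A+1$, so that each further adversary costs two further workers. -/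

import Mathlib

universe u

/-- The data of a Lagrange coded computing scheme with `N` workers, `m` evaluation points per
worker, `m * K` data matrices and `m * T` random masks.  `pts i j` is the `j`-th evaluation point of
worker `i`; `nodes` are the interpolation points, `Sum.inl` for the data matrices and `Sum.inr` for
the masks.  For `m = 1` this is Lagrange coded computing (LCC). -/
structure LagrangeScheme (F : Type*) [Field F] (N K T m : ℕ) where
  /-- evaluation points -/
  pts : Fin N → Fin m → F
  /-- interpolation points -/
  nodes : Fin (m * K) ⊕ Fin (m * T) → F
  pts_injective : Function.Injective fun p : Fin N × Fin m => pts p.1 p.2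
  nodes_injective : Function.Injective nodes
  pts_ne_nodes : ∀ i j k, pts i j ≠ nodes k

namespace LagrangeScheme

variable {F : Type*} [Field F] {N K T m : ℕ}

/-- Folded Lagrange coded computing (FLCC): the evaluation points are the powers
`1, α, α², …, α^(m N - 1)` of a primitive element `α` of the finite field, in consecutive
blocks of `m` points, one block for each worker. -/
def IsFolded [Fintype F] (L : LagrangeScheme F N K T m) (α : F) : Prop :=
  orderOf α = Fintype.card F - 1 ∧
    ∀ (i : Fin N) (j : Fin m), L.pts i j = α ^ (m * (i : ℕ) + (j : ℕ))

/-- The value `u(z)` of the encoding polynomial: entrywise, the Lagrange interpolation polynomial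
that takes the data matrices `X` and the masks `Z` at the interpolation points. -/
noncomputable def encode (L : LagrangeScheme F N K T m) {r h : ℕ}
    (X : Fin (m * K) → Matrix (Fin r) (Fin h) F) (Z : Fin (m * T) → Matrix (Fin r) (Fin h) F)
    (z : F) : Matrix (Fin r) (Fin h) F :=
  Matrix.of fun a b =>
    (Lagrange.interpolate Finset.univ L.nodes (fun k => Sum.elim X Z k a b)).eval z

/-- The value at the matrix `X` of a matrix-valued polynomial function `g`, whose entries are
polynomials in the entries of the input matrix. -/
noncomputable def applyPoly {r h r' h' : ℕ}
    (g : Matrix (Fin r') (Fin h') (MvPolynomial (Fin r × Fin h) F))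
    (X : Matrix (Fin r) (Fin h) F) : Matrix (Fin r') (Fin h') F :=
  Matrix.of fun a b => MvPolynomial.eval (fun p => X p.1 p.2) (g a b)

/-- `y` is a possible list of answers of the workers (`none`: no answer), when there are at most `S`
stragglers and at most `A` Byzantine workers.  A straggler does not answer, a Byzantine worker
behaves arbitrarily, and every other worker `i` returns the values of `g` at its `m` shares. -/
def IsReceived (L : LagrangeScheme F N K T m) (S A : ℕ) {r h r' h' : ℕ}
    (g : Matrix (Fin r') (Fin h') (MvPolynomial (Fin r × Fin h) F))
    (X : Fin (m * K) → Matrix (Fin r) (Fin h) F) (Z : Fin (m * T) → Matrix (Fin r) (Fin h) F)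
    (y : Fin N → Option (Fin m → Matrix (Fin r') (Fin h') F)) : Prop :=
  ∃ strag byz : Finset (Fin N), strag.card ≤ S ∧ byz.card ≤ A ∧
    ∀ i, i ∉ byz →
      y i = if i ∈ strag then none
        else some fun j => applyPoly g (L.encode X Z (L.pts i j))

/-- The scheme is `S`-resilient and `A`-secure for computations of degree at most `D`, when the
master may compute `t` values of `f = g ∘ u` itself for each entry of the output.  For every `g` and
every entry `(a, b)` of the output, from the `(a, b)`-entries of the answers the master first chooses
`t` points, then obtains the true values of the `(a, b)`-entry of `f` there, and from all this
recovers the `(a, b)`-entries of `g` at all the data matrices, whatever the data, the masks, the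
stragglers and the Byzantine workers. -/
def IsResilientSecure (L : LagrangeScheme F N K T m) (S A D t : ℕ) : Prop :=
  ∀ (r h r' h' : ℕ) (g : Matrix (Fin r') (Fin h') (MvPolynomial (Fin r × Fin h) F)),
    (∀ a b, (g a b).totalDegree ≤ D) →
    ∀ (a : Fin r') (b : Fin h'),
    ∃ (query : (Fin N → Option (Fin m → F)) → Fin t → F)
      (decode : (Fin N → Option (Fin m → F)) → (Fin t → F) → Fin (m * K) → F),
      ∀ (X : Fin (m * K) → Matrix (Fin r) (Fin h) F) (Z : Fin (m * T) → Matrix (Fin r) (Fin h) F)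
        (y : Fin N → Option (Fin m → Matrix (Fin r') (Fin h') F)),
        L.IsReceived S A g X Z y →
        ∀ w : Fin N → Option (Fin m → F), w = (fun i => (y i).map fun v j => v j a b) →
          decode w (fun l => applyPoly g (L.encode X Z (query w l)) a b) =
            fun k => applyPoly g (X k) a b

/-- The scheme is `T`-private: for independent uniformly distributed masks, the joint law of the
shares of any at most `T` workers does not depend on the data. -/
def IsPrivate [Fintype F] (L : LagrangeScheme F N K T m) : Prop :=
  ∀ (r h : ℕ) (P : Finset (Fin N)), P.card ≤ T →
    ∀ X X' : Fin (m * K) → Matrix (Fin r) (Fin h) F,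
      (PMF.uniformOfFintype (Fin (m * T) → Matrix (Fin r) (Fin h) F)).map
          (fun Z (i : P) (j : Fin m) => L.encode X Z (L.pts i j)) =
        (PMF.uniformOfFintype (Fin (m * T) → Matrix (Fin r) (Fin h) F)).map
          (fun Z (i : P) (j : Fin m) => L.encode X' Z (L.pts i j))

end LagrangeScheme

/-- Every FLCC with `N` workers, folding parameter `m`, `m * K` data matrices and `m * T` masks, over
any finite field, is `S`-resilient, `A`-secure and `T`-private for computations of degree at most
`D`, with at most `t` extra evaluations of the master for each output entry. -/
def FLCCTolerates (N S K T D m A t : ℕ) : Prop :=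
  ∀ (F : Type u) [Field F] [Fintype F] (α : F) (L : LagrangeScheme F N K T m),
    L.IsFolded α → L.IsResilientSecure S A D t ∧ L.IsPrivate

/-- The modified rate `r = ((K + T - 1/m) D + 1) / (N - S)` of FLCC. -/
noncomputable def modifiedRate (N S K T D m : ℕ) : ℝ :=
  (((K : ℝ) + T - 1 / m) * D + 1) / ((N : ℝ) - S)

/-- The decoding radius `s/(s+1) * (1 - m r / (m - s + 1))`. -/
noncomputable def decodingRadius (m : ℕ) (r : ℝ) (s : ℕ) : ℝ :=
  (s : ℝ) / (s + 1) * (1 - m * r / ((m : ℝ) - s + 1))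

/-- `s = s*`: the integer `s` maximizes the decoding radius over `{1, …, m}`. -/
def IsOptimalOrder (m : ℕ) (r : ℝ) (s : ℕ) : Prop :=
  (1 ≤ s ∧ s ≤ m) ∧ ∀ s' : ℕ, 1 ≤ s' → s' ≤ m → decodingRadius m r s' ≤ decodingRadius m r s

theorem exists_isOptimalOrder {m : ℕ} (hm : 1 ≤ m) (r : ℝ) : ∃ s, IsOptimalOrder m r s := by
  obtain ⟨s, hs, hmax⟩ := Finset.exists_max_image (Finset.Icc 1 m) (decodingRadius m r)
    ⟨1, Finset.mem_Icc.2 ⟨le_refl 1, hm⟩⟩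
  exact ⟨s, Finset.mem_Icc.1 hs, fun s' h1 h2 => hmax s' (Finset.mem_Icc.2 ⟨h1, h2⟩)⟩

/-- The critical point of the decoding radius as a function of a real variable (for `m r ≠ 1`). -/
noncomputable def sTilde (m : ℕ) (r : ℝ) : ℝ :=
  (Real.sqrt (m * (m + 1) * (m * (1 - r) + 2) * r) - (m + 1)) / (m * r - 1)

/-- `s* ∈ {⌈s̃⌉ - 1, ⌈s̃⌉}`, where `s̃` is defined. -/
def HasClosedForm (m : ℕ) (r : ℝ) (s : ℕ) : Prop :=
  m * r ≠ 1 → ((s : ℤ) = ⌈sTilde m r⌉ - 1 ∨ (s : ℤ) = ⌈sTilde m r⌉)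

/-- `⌊(1 - ε) (N - S) - (K + T) D - 1⌋`, an integer that may be negative. -/
noncomputable def flccAdversaries (ε : ℝ) (N S K T D : ℕ) : ℤ :=
  ⌊(1 - ε) * ((N : ℝ) - S) - ((K : ℝ) + T) * D - 1⌋

/-! Recovery is a list-decoding problem. Put `e = D(m(K+T) - 1)`, the degree bound for `g ∘ u`. If
`t` points, chosen after the answers, separate all polynomials of degree at most `e` consistent with
them, the master can decode (`isResilientSecure_of_separating`).

For folded points this is linear-algebraic list decoding of folded Reed–Solomon codes. Each
answering worker supplies `m - s + 1` windows of `s` consecutive values. Counting coefficients gives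
a nonzero relation `A₀ + ∑ B_l Y_l` through all windows, and for a consistent `f` the polynomial `A₀
+ ∑ B_l f(α^l X)` has more roots than its degree allows, so it is zero. Two candidates thus differ
by a solution of `∑ B_l f(α^l X) = 0`. These solutions form a space of dimension at most `s - 1`
(`foldedKernel_finrank_le`), and `s - 1` evaluations separate it.

The count succeeds when `A ≤ (N - S) a(s)` (`flccTolerates_of_le_decodingRadius`), so it remains to
study `a`. An explicit order has radius at least `1 - r - ε`: about `√m` when `m ≥ 1/ε²`, about
`2/ε` when `m` is about `8r₀/ε² + 4/ε` with `r₀ = ((K+T)D + 1)/(N - S)`. A maximizer does at least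
as well. The sign of `a(s+1) - a(s)` bounds it by a multiple of `√(m/r)` and places it next to the
real critical point.

Privacy holds because masks can absorb any change of data unseen by `T` workers. The lower bound for
LCC exhibits one answer list that fits two different data sets. -/

namespace LagrangeScheme

/-! ### Encoding, consistency and unique decoding -/

open Polynomial

variable {F : Type*} [Field F] {N K T m : ℕ}

/-- The entries of the encoding polynomial `u`. -/
noncomputable def encodePoly (L : LagrangeScheme F N K T m) {r h : ℕ}
    (X : Fin (m * K) → Matrix (Fin r) (Fin h) F) (Z : Fin (m * T) → Matrix (Fin r) (Fin h) F)
    (p : Fin r × Fin h) : F[X] :=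
  Lagrange.interpolate Finset.univ L.nodes (fun k => Sum.elim X Z k p.1 p.2)

/-- The univariate polynomial `g ∘ u` for a scalar polynomial function `g`. -/
noncomputable def computedPoly (L : LagrangeScheme F N K T m) {r h : ℕ}
    (g : MvPolynomial (Fin r × Fin h) F)
    (X : Fin (m * K) → Matrix (Fin r) (Fin h) F) (Z : Fin (m * T) → Matrix (Fin r) (Fin h) F) :
    F[X] :=
  MvPolynomial.aeval (L.encodePoly X Z) g

theorem eval_computedPoly (L : LagrangeScheme F N K T m) {r h r' h' : ℕ}
    (g : Matrix (Fin r') (Fin h') (MvPolynomial (Fin r × Fin h) F))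
    (X : Fin (m * K) → Matrix (Fin r) (Fin h) F) (Z : Fin (m * T) → Matrix (Fin r) (Fin h) F)
    (a : Fin r') (b : Fin h') (z : F) :
    (L.computedPoly (g a b) X Z).eval z = applyPoly g (L.encode X Z z) a b := by
  have h1 := MvPolynomial.comp_aeval_apply (L.encodePoly X Z) (Polynomial.aeval z) (g a b)
  rw [Polynomial.coe_aeval_eq_eval] at h1
  rw [computedPoly, h1]
  exact DFunLike.congr_fun (MvPolynomial.coe_aeval_eq_eval _) _

theorem encode_node (L : LagrangeScheme F N K T m) {r h : ℕ}
    (X : Fin (m * K) → Matrix (Fin r) (Fin h) F) (Z : Fin (m * T) → Matrix (Fin r) (Fin h) F)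
    (k : Fin (m * K) ⊕ Fin (m * T)) : L.encode X Z (L.nodes k) = Sum.elim X Z k := by
  ext a b
  simp only [encode, Matrix.of_apply]
  exact Lagrange.eval_interpolate_at_node _ L.nodes_injective.injOn (Finset.mem_univ k)

theorem natDegree_encodePoly_le (L : LagrangeScheme F N K T m) {r h : ℕ}
    (X : Fin (m * K) → Matrix (Fin r) (Fin h) F) (Z : Fin (m * T) → Matrix (Fin r) (Fin h) F)
    (p : Fin r × Fin h) : (L.encodePoly X Z p).natDegree ≤ m * (K + T) - 1 := by
  have h1 := Lagrange.degree_interpolate_lt (s := Finset.univ) (v := L.nodes)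
    (fun k => Sum.elim X Z k p.1 p.2) L.nodes_injective.injOn
  rw [Finset.card_univ, Fintype.card_sum, Fintype.card_fin, Fintype.card_fin, ← mul_add] at h1
  have h2 : (L.encodePoly X Z p).degree < (m * (K + T) : ℕ) := h1
  by_cases h0 : L.encodePoly X Z p = 0
  · simp [h0]
  · have := (natDegree_lt_iff_degree_lt h0).2 h2
    omega

theorem natDegree_computedPoly_le (L : LagrangeScheme F N K T m) {r h D : ℕ}
    (g : MvPolynomial (Fin r × Fin h) F) (hg : g.totalDegree ≤ D)
    (X : Fin (m * K) → Matrix (Fin r) (Fin h) F) (Z : Fin (m * T) → Matrix (Fin r) (Fin h) F) :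
    (L.computedPoly g X Z).natDegree ≤ D * (m * (K + T) - 1) :=
  MvPolynomial.aeval_natDegree_le g hg _ (L.natDegree_encodePoly_le X Z)

/-- The answers `w` of the workers are consistent with the polynomial `f`, up to at most `S`
stragglers and `A` Byzantine workers. -/
def IsConsistent (L : LagrangeScheme F N K T m) (S A : ℕ) (w : Fin N → Option (Fin m → F))
    (f : F[X]) : Prop :=
  ∃ strag byz : Finset (Fin N), strag.card ≤ S ∧ byz.card ≤ A ∧
    ∀ i, i ∉ byz → w i = if i ∈ strag then none else some fun j => f.eval (L.pts i j)

theorem IsReceived.isConsistent {L : LagrangeScheme F N K T m} {S A r h r' h' : ℕ}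
    {g : Matrix (Fin r') (Fin h') (MvPolynomial (Fin r × Fin h) F)}
    {X : Fin (m * K) → Matrix (Fin r) (Fin h) F} {Z : Fin (m * T) → Matrix (Fin r) (Fin h) F}
    {y : Fin N → Option (Fin m → Matrix (Fin r') (Fin h') F)} (hy : L.IsReceived S A g X Z y)
    (a : Fin r') (b : Fin h') :
    L.IsConsistent S A (fun i => (y i).map fun v j => v j a b) (L.computedPoly (g a b) X Z) := by
  obtain ⟨strag, byz, hs, hb, H⟩ := hy
  refine ⟨strag, byz, hs, hb, fun i hi => ?_⟩
  simp only [H i hi]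
  split_ifs <;> simp [eval_computedPoly]

/-- Resilience and security follow once, for every list of answers, `t` evaluation points
distinguish all the low-degree polynomials that are consistent with the answers. -/
theorem isResilientSecure_of_separating (L : LagrangeScheme F N K T m) {S A D t : ℕ}
    (H : ∀ w : Fin N → Option (Fin m → F), ∃ q : Fin t → F, ∀ f f' : F[X],
      f.natDegree ≤ D * (m * (K + T) - 1) → f'.natDegree ≤ D * (m * (K + T) - 1) →
      L.IsConsistent S A w f → L.IsConsistent S A w f' →
      (∀ l, f.eval (q l) = f'.eval (q l)) → f = f') :
    L.IsResilientSecure S A D t := by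
  classical
  choose q hq using H
  intro r h r' h' g hg a b
  let P (w : Fin N → Option (Fin m → F)) (v : Fin t → F) (f : F[X]) : Prop :=
    f.natDegree ≤ D * (m * (K + T) - 1) ∧ L.IsConsistent S A w f ∧ ∀ l, f.eval (q w l) = v l
  -- The decoder evaluates any admissible polynomial at the data nodes; the default `0` never occurs
  -- for genuine answers.
  refine ⟨q, fun w v k => if hP : ∃ f, P w v f then hP.choose.eval (L.nodes (Sum.inl k)) else 0, ?_⟩
  rintro X Z y hy w rfl
  set w : Fin N → Option (Fin m → F) := fun i => (y i).map fun v j => v j a b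
  have hf : P w (fun l => applyPoly g (L.encode X Z (q w l)) a b)
      (L.computedPoly (g a b) X Z) :=
    ⟨L.natDegree_computedPoly_le _ (hg a b) X Z, hy.isConsistent a b,
      fun l => L.eval_computedPoly g X Z a b _⟩
  have hex : ∃ f, P w (fun l => applyPoly g (L.encode X Z (q w l)) a b) f := ⟨_, hf⟩
  funext k
  have heq : hex.choose = L.computedPoly (g a b) X Z :=
    hq w _ _ hex.choose_spec.1 hf.1 hex.choose_spec.2.1 hf.2.1
      fun l => (hex.choose_spec.2.2 l).trans (hf.2.2 l).symm
  refine (dif_pos hex).trans ?_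
  rw [heq, eval_computedPoly, encode_node, Sum.elim_inl]

/-- The polynomials consistent with the same answers agree at all the points of the workers outside
a set of at most `S + 2 * A` workers. -/
theorem IsConsistent.exists_agree {L : LagrangeScheme F N K T m} {S A : ℕ}
    {w : Fin N → Option (Fin m → F)} {f f' : F[X]} (hf : L.IsConsistent S A w f)
    (hf' : L.IsConsistent S A w f') :
    ∃ G : Finset (Fin N), N ≤ G.card + S + 2 * A ∧
      ∀ i ∈ G, ∀ j, f.eval (L.pts i j) = f'.eval (L.pts i j) := by
  classical
  obtain ⟨s₁, b₁, hs₁, hb₁, H₁⟩ := hf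
  obtain ⟨s₂, b₂, hs₂, hb₂, H₂⟩ := hf'
  -- Outside `b₁ ∪ b₂` both straggler sets are read off from the same `w`, so they coincide there
  -- and `S` is charged only once.
  refine ⟨(s₁ ∪ (b₁ ∪ b₂))ᶜ, ?_, fun i hi j => ?_⟩
  · have h1 := Finset.card_union_le s₁ (b₁ ∪ b₂)
    have h2 := Finset.card_union_le b₁ b₂
    have h3 := Finset.card_add_card_compl (s₁ ∪ (b₁ ∪ b₂))
    rw [Fintype.card_fin] at h3
    omega
  · simp only [Finset.mem_compl, Finset.mem_union, not_or] at hi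
    have h1 := H₁ i hi.2.1
    rw [H₂ i hi.2.2, if_neg hi.1] at h1
    split_ifs at h1
    exact (congrFun (Option.some.inj h1) j).symm

/-- A polynomial consistent with the answers agrees with nearly all the answers. -/
theorem IsConsistent.exists_agree_answers {L : LagrangeScheme F N K T m} {S A : ℕ}
    {w : Fin N → Option (Fin m → F)} {f : F[X]} (hf : L.IsConsistent S A w f) :
    ∃ G : Finset (Fin N), N ≤ S + A + G.card ∧
      (Finset.univ.filter fun i => (w i).isSome).card ≤ G.card + A ∧
      ∀ i ∈ G, w i = some fun j => f.eval (L.pts i j) := by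
  classical
  obtain ⟨s, b, hs, hb, H⟩ := hf
  refine ⟨(s ∪ b)ᶜ, ?_, ?_, fun i hi => ?_⟩
  · have h1 := Finset.card_union_le s b
    have h3 := Finset.card_add_card_compl (s ∪ b)
    rw [Fintype.card_fin] at h3
    omega
  -- A worker that answers but lies outside `G` is Byzantine.
  · have : (Finset.univ.filter fun i => (w i).isSome) ⊆ (s ∪ b)ᶜ ∪ b := by
      intro i hi
      by_cases hib : i ∈ b
      · exact Finset.mem_union_right _ hib
      · refine Finset.mem_union_left _ ?_
        simp only [Finset.mem_compl, Finset.mem_union, not_or]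
        refine ⟨fun his => ?_, hib⟩
        simp [H i hib, his] at hi
    exact (Finset.card_le_card this).trans ((Finset.card_union_le _ _).trans (by omega))
  · simp only [Finset.mem_compl, Finset.mem_union, not_or] at hi
    rw [H i hi.2, if_neg hi.1]

/-- Polynomials that agree at sufficiently many workers are equal. -/
theorem eq_of_agree (L : LagrangeScheme F N K T m) {f f' : F[X]} (e : ℕ) (hf : f.natDegree ≤ e)
    (hf' : f'.natDegree ≤ e) (G : Finset (Fin N)) (hG : e < G.card * m)
    (H : ∀ i ∈ G, ∀ j, f.eval (L.pts i j) = f'.eval (L.pts i j)) : f = f' := by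
  rw [← sub_eq_zero]
  refine eq_zero_of_natDegree_lt_card_of_eval_eq_zero (f - f')
    (f := fun p : G × Fin m => L.pts p.1 p.2) ?_ ?_ ?_
  · intro p p' hp
    have := @L.pts_injective (p.1.1, p.2) (p'.1.1, p'.2) hp
    simp only [Prod.mk.injEq] at this
    exact Prod.ext (Subtype.ext this.1) this.2
  · intro p
    rw [eval_sub, H _ p.1.2, sub_self]
  · rw [Fintype.card_prod, Fintype.card_fin, Fintype.card_coe]
    exact (natDegree_sub_le_of_le hf hf').trans_lt (by simpa using hG)

/-- Two consistent polynomials agree at `N - S - 2A` or more points, which exceeds their degree, so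
the answers alone determine the polynomial. -/
theorem lcc_isResilientSecure {S A D : ℕ} (L : LagrangeScheme F N K T 1)
    (hN : (K + T - 1) * D + S + 2 * A + 1 ≤ N) : L.IsResilientSecure S A D 0 := by
  refine L.isResilientSecure_of_separating fun w => ⟨Fin.elim0, fun f f' hf hf' hw hw' _ => ?_⟩
  obtain ⟨G, hG, H⟩ := hw.exists_agree hw'
  rw [one_mul, mul_comm] at hf hf'
  exact L.eq_of_agree _ hf hf' G (by omega) H

/-- A polynomial of low degree is the encoding polynomial of its values at the interpolation
points. -/
theorem encode_eq_of_natDegree_lt (L : LagrangeScheme F N K T m) {r h : ℕ}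
    (v : Fin r → Fin h → F[X]) (hv : ∀ a b, (v a b).degree < (m * (K + T) : ℕ)) (z : F) :
    L.encode (fun k => Matrix.of fun a b => (v a b).eval (L.nodes (Sum.inl k)))
      (fun k => Matrix.of fun a b => (v a b).eval (L.nodes (Sum.inr k))) z =
      Matrix.of fun a b => (v a b).eval z := by
  ext a b
  simp only [encode, Matrix.of_apply]
  congr 1
  symm
  refine Lagrange.eq_interpolate_of_eval_eq _ L.nodes_injective.injOn ?_ ?_
  · rw [Finset.card_univ, Fintype.card_sum, Fintype.card_fin, Fintype.card_fin, ← mul_add]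
    exact hv a b
  · rintro (k | k) - <;> simp

/-! ### Privacy, and the lower bound for LCC -/

theorem encode_add (L : LagrangeScheme F N K T m) {r h : ℕ}
    (X X' : Fin (m * K) → Matrix (Fin r) (Fin h) F)
    (Z Z' : Fin (m * T) → Matrix (Fin r) (Fin h) F) (z : F) :
    L.encode (X + X') (Z + Z') z = L.encode X Z z + L.encode X' Z' z := by
  ext a b
  simp only [encode, Matrix.of_apply, Matrix.add_apply]
  rw [← eval_add, ← map_add]
  congr 2
  funext k
  cases k <;> simp

/-- Any change of the data can be hidden from any `T` workers by a change of the masks. -/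
theorem exists_mask_shift (L : LagrangeScheme F N K T m) {r h : ℕ} (P : Finset (Fin N))
    (hP : P.card ≤ T) (X : Fin (m * K) → Matrix (Fin r) (Fin h) F) :
    ∃ Z : Fin (m * T) → Matrix (Fin r) (Fin h) F, ∀ i ∈ P, ∀ j, L.encode X Z (L.pts i j) = 0 := by
  classical
  let pt : Fin N × Fin m → F := fun p => L.pts p.1 p.2
  let G : F[X] := Lagrange.nodal (P ×ˢ Finset.univ) pt
  have hG : ∀ k, G.eval (L.nodes k) ≠ 0 := fun k =>
    Lagrange.eval_nodal_not_at_node fun p _ => (L.pts_ne_nodes p.1 p.2 k).symm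
  -- `G` vanishes at every share of `P`; dividing the data by its node values first makes the
  -- product interpolate the data. The degree stays below `mT + mK`.
  let v : Fin r → Fin h → F[X] := fun a b =>
    G * Lagrange.interpolate Finset.univ (fun k => L.nodes (Sum.inl k))
      fun k => X k a b / G.eval (L.nodes (Sum.inl k))
  have hinj : Function.Injective fun k : Fin (m * K) => L.nodes (Sum.inl k) :=
    L.nodes_injective.comp Sum.inl_injective
  have hdeg : ∀ a b, (v a b).degree < (m * (K + T) : ℕ) := by
    intro a b
    have h1 := Lagrange.degree_interpolate_lt (s := Finset.univ)
      (fun k => X k a b / G.eval (L.nodes (Sum.inl k))) hinj.injOn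
    rw [Finset.card_univ, Fintype.card_fin] at h1
    rw [degree_mul, Lagrange.degree_nodal, Finset.card_product, Finset.card_univ,
      Fintype.card_fin]
    have h2 : ((P.card * m : ℕ) : WithBot ℕ) ≤ (m * T : ℕ) := by
      rw [Nat.cast_le, mul_comm]
      exact Nat.mul_le_mul_left m hP
    rw [mul_add, add_comm (m * K), Nat.cast_add]
    refine (add_le_add_left h2 _).trans_lt ?_
    exact WithBot.add_lt_add_left (by exact WithBot.natCast_ne_bot _) h1
  have hX : X = fun k => Matrix.of fun a b => (v a b).eval (L.nodes (Sum.inl k)) := by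
    funext k
    ext a b
    have h1 := Lagrange.eval_interpolate_at_node (s := Finset.univ)
      (fun k => X k a b / G.eval (L.nodes (Sum.inl k))) hinj.injOn (Finset.mem_univ k)
    simp only [v, Matrix.of_apply, eval_mul]
    rw [h1, mul_div_cancel₀ _ (hG _)]
  refine ⟨fun k => Matrix.of fun a b => (v a b).eval (L.nodes (Sum.inr k)), fun i hi j => ?_⟩
  rw [hX, L.encode_eq_of_natDegree_lt v hdeg]
  ext a b
  have : G.eval (pt (i, j)) = 0 :=
    Lagrange.eval_nodal_at_node (Finset.mem_product.2 ⟨hi, Finset.mem_univ j⟩)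
  simp only [v, Matrix.of_apply, eval_mul, Matrix.zero_apply]
  exact mul_eq_zero_of_left this _

theorem _root_.PMF.map_uniformOfFintype_equiv {α : Type*} [Fintype α] [Nonempty α] (e : α ≃ α) :
    (PMF.uniformOfFintype α).map e = PMF.uniformOfFintype α := by
  ext x
  rw [PMF.map_apply, tsum_eq_single (e.symm x)]
  · simp
  · intro y hy
    rw [if_neg]
    rintro rfl
    simp at hy

/-- Adding to the masks a `Δ` that hides `X' - X` keeps every share of `P` unchanged, and
translation preserves the uniform law. -/
theorem isPrivate [Fintype F] (L : LagrangeScheme F N K T m) : L.IsPrivate := by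
  intro r h P hP X X'
  obtain ⟨Δ, hΔ⟩ := L.exists_mask_shift P hP (X' - X)
  conv_rhs => rw [← PMF.map_uniformOfFintype_equiv (Equiv.addRight Δ), PMF.map_comp]
  congr 1
  funext Z i j
  have := L.encode_add X (X' - X) Z Δ (L.pts i j)
  rw [add_sub_cancel, hΔ i i.2 j, add_zero] at this
  exact this.symm

/-- The product of linear factors over at most `D * d` points is a product of `D` polynomials of
degree at most `d`. -/
theorem exists_prod_eq_of_card_le {ι : Type*} (d : ℕ) (v : ι → F) :
    ∀ (D : ℕ) (W : Finset ι), W.card ≤ D * d → ∃ p : Fin D → F[X],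
      (∀ l, (p l).natDegree ≤ d) ∧ ∏ l, p l = Lagrange.nodal W v := by
  classical
  intro D
  induction D with
  | zero =>
    intro W hW
    have : W = ∅ := by simpa using hW
    exact ⟨fun _ => 1, by simp, by simp [this]⟩
  | succ D ih =>
    intro W hW
    obtain ⟨V, hV, hVc⟩ := Finset.exists_subset_card_eq (Nat.min_le_right d W.card)
    obtain ⟨p, hp, hprod⟩ := ih (W \ V) (by
      rw [Finset.card_sdiff_of_subset hV, hVc]
      rw [add_mul, one_mul] at hW
      omega)
    refine ⟨Fin.cons (Lagrange.nodal V v) p, fun l => ?_, ?_⟩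
    · refine Fin.cases ?_ (fun l => ?_) l
      · rw [Fin.cons_zero, Lagrange.natDegree_nodal, hVc]
        exact Nat.min_le_left _ _
      · rw [Fin.cons_succ]
        exact hp l
    · rw [Fin.prod_univ_succ]
      simp only [Fin.cons_zero, Fin.cons_succ, hprod, Lagrange.nodal]
      rw [mul_comm]
      exact Finset.prod_sdiff hV

/-- With `g` a product of `D` entries, `g ∘ u` can be the nodal polynomial of any `D(K+T-1)` or
fewer workers. At these workers it looks like zero data, yet it is nonzero at every data node. -/
theorem lcc_le_card_of_isResilientSecure {S A D : ℕ} (hK : 1 ≤ K) (hD : 1 ≤ D)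
    (L : LagrangeScheme F N K T 1) (H : L.IsResilientSecure S A D 0) :
    (K + T - 1) * D + S + 2 * A + 1 ≤ N := by
  classical
  by_contra hN
  push Not at hN
  -- `s` stragglers, two groups of Byzantine workers, and the roots of the confusing polynomial
  obtain ⟨s, -, hs⟩ := Finset.exists_subset_card_eq
    (s := (Finset.univ : Finset (Fin N))) (n := min S N) (by simp)
  obtain ⟨b₁, hb₁s, hb₁⟩ := Finset.exists_subset_card_eq (s := sᶜ) (n := min A (sᶜ).card) (by simp)
  obtain ⟨b₂, hb₂s, hb₂⟩ := Finset.exists_subset_card_eq (s := sᶜ \ b₁)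
    (n := min A (sᶜ \ b₁).card) (by simp)
  set W : Finset (Fin N) := (sᶜ \ b₁) \ b₂ with hW
  have hWc : W.card ≤ D * (K + T - 1) := by
    have h1 := Finset.card_add_card_compl s
    have h2 := Finset.card_sdiff_add_card_eq_card hb₁s
    have h3 := Finset.card_sdiff_add_card_eq_card hb₂s
    rw [Fintype.card_fin] at h1
    rw [← hW] at h3
    rw [mul_comm D]
    omega
  obtain ⟨p, hp, hprod⟩ := exists_prod_eq_of_card_le (K + T - 1) (fun i => L.pts i 0) D W hWc
  let g : Matrix (Fin 1) (Fin 1) (MvPolynomial (Fin 1 × Fin D) F) :=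
    Matrix.of fun _ _ => ∏ l, MvPolynomial.X (0, l)
  have hg : ∀ a b, (g a b).totalDegree ≤ D := by
    intro a b
    refine (MvPolynomial.totalDegree_finsetProd Finset.univ
      fun l : Fin D => (MvPolynomial.X (0, l) : MvPolynomial (Fin 1 × Fin D) F)).trans ?_
    simp
  let v : Fin 1 → Fin D → F[X] := fun _ l => p l
  have hv : ∀ a b, (v a b).degree < (1 * (K + T) : ℕ) := by
    intro a b
    refine degree_le_natDegree.trans_lt ?_
    rw [Nat.cast_lt]
    have := hp b
    simp only [v]
    omega
  let X : Fin (1 * K) → Matrix (Fin 1) (Fin D) F :=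
    fun k => Matrix.of fun a b => (v a b).eval (L.nodes (Sum.inl k))
  let Z : Fin (1 * T) → Matrix (Fin 1) (Fin D) F :=
    fun k => Matrix.of fun a b => (v a b).eval (L.nodes (Sum.inr k))
  have happ : ∀ M, applyPoly g M 0 0 = ∏ l, M 0 l := by
    intro M
    simp [applyPoly, g]
  have henc : ∀ z, applyPoly g (L.encode X Z z) 0 0 =
      (Lagrange.nodal W fun i => L.pts i 0).eval z := by
    intro z
    rw [happ, L.encode_eq_of_natDegree_lt v hv, ← hprod, eval_prod]
    rfl
  have henc0 : ∀ z, applyPoly g (L.encode 0 0 z) 0 0 = 0 := by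
    intro z
    rw [happ]
    refine Finset.prod_eq_zero (Finset.mem_univ ⟨0, hD⟩) ?_
    have := L.encode_add (0 : Fin (1 * K) → Matrix (Fin 1) (Fin D) F) 0 0 0 z
    simp only [add_zero] at this
    rw [left_eq_add.1 this]
    rfl
  -- `b₁` answers as for `(X, Z)`, `b₂` as for zero data, and `W` fits both: either group may be the
  -- Byzantine one.
  let y : Fin N → Option (Fin 1 → Matrix (Fin 1) (Fin 1) F) := fun i =>
    if i ∈ s then none else if i ∈ b₂ then some 0 else
      some fun j => applyPoly g (L.encode X Z (L.pts i j))
  obtain ⟨query, decode, hdec⟩ := H 1 D 1 1 g hg 0 0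
  have h1 := hdec X Z y ⟨s, b₂, by omega, by omega, fun i hi => by simp [y, hi]⟩ _ rfl
  have hmat : ∀ M M' : Matrix (Fin 1) (Fin 1) F, M 0 0 = M' 0 0 → M = M' := fun M M' hM => by
    ext a b
    rwa [Subsingleton.elim a 0, Subsingleton.elim b 0]
  have hW0 : ∀ i ∈ W, ∀ j, applyPoly g (L.encode X Z (L.pts i j)) =
      applyPoly g (L.encode 0 0 (L.pts i j)) := fun i hi j => by
    refine hmat _ _ ?_
    rw [henc0, henc, Subsingleton.elim j 0]
    exact Lagrange.eval_nodal_at_node (v := fun i => L.pts i 0) hi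
  have hzero : ∀ z, 0 = applyPoly g (L.encode 0 0 z) := fun z => hmat _ _ (henc0 z).symm
  have h2 := hdec 0 0 y ⟨s, b₁, by omega, by omega, fun i hi => by
    simp only [y]
    by_cases hs2 : i ∈ s
    · rw [if_pos hs2, if_pos hs2]
    by_cases hb2 : i ∈ b₂
    · rw [if_neg hs2, if_neg hs2, if_pos hb2]
      exact congrArg some (funext fun j => hzero _)
    · rw [if_neg hs2, if_neg hs2, if_neg hb2]
      have hiW : i ∈ W := by simp [hW, hs2, hb2, hi]
      exact congrArg some (funext fun j => hW0 i hiW j)⟩ _ rfl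
  have h3 := congrFun (h1.symm.trans ((congrArg (decode _) (Subsingleton.elim _ _)).trans h2))
    ⟨0, by omega⟩
  have h4 := henc (L.nodes (Sum.inl ⟨0, by omega⟩))
  have h5 := henc0 (L.nodes (Sum.inl ⟨0, by omega⟩))
  rw [encode_node, Sum.elim_inl] at h4 h5
  replace h3 := h4.symm.trans (h3.trans h5)
  exact Lagrange.eval_nodal_not_at_node (fun i _ => (L.pts_ne_nodes i 0 _).symm) h3

end LagrangeScheme

/-! ### Linear-algebraic list decoding -/

section LinearAlgebraicDecoding

open Polynomial

variable {F : Type*} [Field F]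

/-- A `t`-dimensional space of vectors that is separated by a family of functionals is separated by
`t` of them. -/
theorem exists_separating_family {V ι : Type*} [AddCommGroup V] [Module F V] [Nonempty ι]
    (ev : ι → V →ₗ[F] F) :
    ∀ (t : ℕ) (W : Submodule F V) [FiniteDimensional F W], Module.finrank F W ≤ t →
      (∀ f ∈ W, (∀ x, ev x f = 0) → f = 0) →
      ∃ q : Fin t → ι, ∀ f ∈ W, (∀ l, ev (q l) f = 0) → f = 0 := by
  intro t
  induction t with
  | zero =>
    intro W _ hW _
    have : W = ⊥ := Submodule.finrank_eq_zero.1 (Nat.le_zero.1 hW)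
    exact ⟨Fin.elim0, fun f hf _ => by simpa [this] using hf⟩
  | succ t ih =>
    intro W _ hW hsep
    by_cases hbot : W = ⊥
    · exact ⟨fun _ => Classical.arbitrary ι, fun f hf _ => by simpa [hbot] using hf⟩
    obtain ⟨f₀, hf₀, hne⟩ := Submodule.exists_mem_ne_zero_of_ne_bot hbot
    obtain ⟨x, hx⟩ : ∃ x, ev x f₀ ≠ 0 := by
      by_contra! hall
      exact hne (hsep f₀ hf₀ hall)
    -- A point where some element of `W` is nonzero lowers the dimension by at least one.
    have hlt : W ⊓ LinearMap.ker (ev x) < W :=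
      lt_of_le_of_ne inf_le_left fun heq => hx (heq.symm ▸ hf₀ : f₀ ∈ W ⊓ LinearMap.ker (ev x)).2
    have : FiniteDimensional F (W ⊓ LinearMap.ker (ev x) : Submodule F V) :=
      Submodule.finiteDimensional_of_le hlt.le
    obtain ⟨q, hq⟩ := ih (W ⊓ LinearMap.ker (ev x))
      (by have := Submodule.finrank_lt_finrank_of_lt hlt; omega)
      (fun f hf => hsep f hf.1)
    refine ⟨Fin.cons x q, fun f hf hz => hq f ⟨hf, by simpa using hz 0⟩ fun l => ?_⟩
    simpa using hz l.succ

/-- The polynomials `f` of degree at most `e` with `∑ l, B l * f (γ ^ l * X) = 0`. -/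
noncomputable def foldedKernel {s : ℕ} (γ : F) (B : Fin s → F[X]) (e : ℕ) : Submodule F F[X] :=
  degreeLT F (e + 1) ⊓ LinearMap.ker
    (∑ l, LinearMap.mulLeft F (B l) ∘ₗ
      (Polynomial.aeval (C (γ ^ (l : ℕ)) * X : F[X])).toLinearMap)

theorem mem_foldedKernel {s : ℕ} {γ : F} {B : Fin s → F[X]} {e : ℕ} {f : F[X]} :
    f ∈ foldedKernel γ B e ↔
      f.natDegree ≤ e ∧ ∑ l, B l * f.comp (C (γ ^ (l : ℕ)) * X) = 0 := by
  rw [foldedKernel, Submodule.mem_inf, degreeLT_succ_eq_degreeLE, mem_degreeLE,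
    natDegree_le_iff_degree_le, LinearMap.mem_ker, LinearMap.sum_apply]
  rfl

/-- Let `v` be the lowest exponent occurring in any `B l`, and `b = ∑ (B l)_v X^l ≠ 0`. The
coefficient of `X^(v+j)` in the equation is `b(γ^j) f_j` plus terms in earlier `f_i`. Hence `f` is
determined by the `f_j` with `b(γ^j) = 0`. There are at most `s - 1` of these, as `deg b < s` and
the `γ^j` with `j ≤ e < orderOf γ` are distinct. -/
theorem foldedKernel_finrank_le {s : ℕ} {γ : F} {B : Fin s → F[X]} (hB : B ≠ 0) {e : ℕ}
    (he : e < orderOf γ) :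
    FiniteDimensional F (foldedKernel γ B e) ∧
      Module.finrank F (foldedKernel γ B e) + 1 ≤ s := by
  classical
  have hex : ∃ v, ∃ l, (B l).coeff v ≠ 0 := by
    by_contra! hall
    exact hB (funext fun l => Polynomial.ext fun v => by simpa using hall v l)
  obtain ⟨l₀, hl₀⟩ := Nat.find_spec hex
  have hmin : ∀ u < Nat.find hex, ∀ l, (B l).coeff u = 0 := fun u hu l => by
    by_contra h
    exact Nat.find_min hex hu ⟨l, h⟩
  set v := Nat.find hex
  let b : F[X] := ∑ l, C ((B l).coeff v) * X ^ (l : ℕ)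
  have hbne : b ≠ 0 := by
    intro h0
    apply hl₀
    have : b.coeff l₀ = (B l₀).coeff v := by
      simp only [b, finsetSum_coeff, coeff_C_mul, coeff_X_pow]
      rw [Finset.sum_eq_single l₀]
      · simp
      · intro l _ hl
        rw [if_neg (fun h => hl (Fin.ext h.symm)), mul_zero]
      · simp
    rw [← this, h0, coeff_zero]
  have hbdeg : b.natDegree ≤ s - 1 := by
    refine natDegree_sum_le_of_forall_le _ _ fun l _ => ?_
    refine (natDegree_C_mul_X_pow_le _ _).trans ?_
    have := l.2
    omega
  let J : Finset ℕ := (Finset.range (e + 1)).filter fun j => b.eval (γ ^ j) = 0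
  have hJ : J.card ≤ s - 1 := by
    refine le_trans ?_ ((Multiset.toFinset_card_le _).trans ((card_roots' b).trans hbdeg))
    refine Finset.card_le_card_of_injOn (fun j => γ ^ j) ?_ ?_
    · intro j hj
      simp only [J, Finset.coe_filter, Set.mem_ofPred_eq] at hj
      simp [hbne, hj.2]
    · intro i hi j hj hij
      simp only [J, Finset.coe_filter, Finset.mem_range, Set.mem_ofPred_eq] at hi hj
      exact pow_injOn_Iio_orderOf (show i < orderOf γ by omega) (show j < orderOf γ by omega) hij
  have hzero : ∀ f ∈ foldedKernel γ B e, (∀ j ∈ J, f.coeff j = 0) → f = 0 := by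
    intro f hf hfJ
    rw [mem_foldedKernel] at hf
    ext j
    rw [coeff_zero]
    induction j using Nat.strong_induction_on with
    | _ j ih =>
      by_cases hj : e < j
      · exact coeff_eq_zero_of_natDegree_lt (hf.1.trans_lt hj)
      by_cases hjJ : b.eval (γ ^ j) = 0
      · exact hfJ j (Finset.mem_filter.2 ⟨Finset.mem_range.2 (by omega), hjJ⟩)
      have h1 := congrArg (fun p => coeff p (v + j)) hf.2
      simp only [finsetSum_coeff, coeff_zero] at h1
      have h2 : ∀ l, (B l * f.comp (C (γ ^ (l : ℕ)) * X)).coeff (v + j) =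
          (B l).coeff v * (γ ^ j) ^ (l : ℕ) * f.coeff j := by
        intro l
        rw [Polynomial.coeff_mul, Finset.sum_eq_single (v, j)]
        · rw [comp_C_mul_X_coeff, ← pow_mul, ← pow_mul, mul_comm j]
          ring
        · rintro ⟨x, y⟩ hxy hne
          replace hxy : x + y = v + j := Finset.HasAntidiagonal.mem_antidiagonal.1 hxy
          simp only
          rcases lt_trichotomy x v with hx | hx | hx
          · rw [hmin x hx, zero_mul]
          · exact absurd (Prod.ext hx (by simp only; omega)) hne
          · rw [comp_C_mul_X_coeff, ih y (by omega), zero_mul, mul_zero]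
        · simp
      rw [Finset.sum_congr rfl fun l _ => h2 l, ← Finset.sum_mul] at h1
      have h3 : ∑ l, (B l).coeff v * (γ ^ j) ^ (l : ℕ) = b.eval (γ ^ j) := by
        simp [b, eval_finsetSum]
      rw [h3] at h1
      exact (mul_eq_zero.1 h1).resolve_left hjJ
  let φ : foldedKernel γ B e →ₗ[F] (J → F) :=
    LinearMap.pi fun j => (lcoeff F j) ∘ₗ (foldedKernel γ B e).subtype
  have hφ : Function.Injective φ := by
    rw [← LinearMap.ker_eq_bot, LinearMap.ker_eq_bot']
    intro f hf
    refine Subtype.ext (hzero f f.2 fun j hj => ?_)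
    exact congrFun hf ⟨j, hj⟩
  have hs : 0 < s := l₀.pos
  refine ⟨Module.Finite.of_injective φ hφ, ?_⟩
  have := LinearMap.finrank_le_finrank_of_injective hφ
  rw [Module.finrank_fintype_fun_eq_card, Fintype.card_coe] at this
  omega

/-- Interpolation step: fewer linear constraints than coefficients leave a nonzero
`A₀ + ∑ l, B l * Y l` that vanishes at the given points. -/
theorem exists_interpolating_relation {κ : Type*} [Fintype κ] (x : κ → F) {s : ℕ}
    (Y : κ → Fin s → F) (d e : ℕ) (hcard : Fintype.card κ < (d + 1) * (s + 1) + e) :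
    ∃ (A₀ : F[X]) (B : Fin s → F[X]), (A₀ ≠ 0 ∨ B ≠ 0) ∧ A₀.natDegree ≤ d + e ∧
      (∀ l, (B l).natDegree ≤ d) ∧ ∀ c, A₀.eval (x c) + ∑ l, (B l).eval (x c) * Y c l = 0 := by
  let Φ : (degreeLT F (d + e + 1) × (Fin s → degreeLT F (d + 1))) →ₗ[F] (κ → F) :=
    LinearMap.pi fun c =>
      ((leval (x c)) ∘ₗ (degreeLT F (d + e + 1)).subtype) ∘ₗ LinearMap.fst F _ _ +
        ∑ l, Y c l • ((leval (x c)) ∘ₗ (degreeLT F (d + 1)).subtype ∘ₗ LinearMap.proj l) ∘ₗ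
          LinearMap.snd F _ _
  have hfin : ∀ n, Module.finrank F (degreeLT F n) = n := fun n => by
    rw [(degreeLTEquiv F n).finrank_eq, Module.finrank_fin_fun]
  have hfd : ∀ n, FiniteDimensional F (degreeLT F n) := fun n =>
    Module.Finite.equiv (degreeLTEquiv F n).symm
  have hker : LinearMap.ker Φ ≠ ⊥ := by
    refine LinearMap.ker_ne_bot_of_finrank_lt ?_
    rw [Module.finrank_fintype_fun_eq_card, Module.finrank_prod, Module.finrank_pi_fintype]
    simp only [hfin, Finset.sum_const, Finset.card_univ, Fintype.card_fin, smul_eq_mul]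
    nlinarith
  obtain ⟨⟨A₀, B⟩, hmem, hne⟩ := Submodule.exists_mem_ne_zero_of_ne_bot hker
  have hdeg : ∀ {n} (p : degreeLT F (n + 1)), (p : F[X]).natDegree ≤ n := by
    intro n p
    have h1 : (p : F[X]) ∈ degreeLE F n := degreeLT_succ_eq_degreeLE (R := F) ▸ p.2
    exact natDegree_le_iff_degree_le.2 (mem_degreeLE.1 h1)
  refine ⟨A₀, fun l => B l, ?_, hdeg _, fun l => hdeg _, fun c => ?_⟩
  · by_contra! h0
    apply hne
    refine Prod.ext (Subtype.ext h0.1) (funext fun l => Subtype.ext (congrFun h0.2 l))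
  · have := congrFun (LinearMap.mem_ker.1 hmem) c
    simp [Φ, leval_apply] at this
    simpa [mul_comm] using this

end LinearAlgebraicDecoding

/-! ### List decoding of FLCC answers -/

namespace LagrangeScheme

open Polynomial

variable {F : Type*} [Field F] {N K T m : ℕ}

/-- The polynomials consistent with given answers differ by elements of a space of dimension less
than `s`. -/
theorem exists_foldedKernel_of_isConsistent [Fintype F] (L : LagrangeScheme F N K T m) {α : F}
    (hL : L.IsFolded α) {S A s e : ℕ} (hs : 1 ≤ s) (hsm : s ≤ m)
    (H : A * (s + 1) * (m - s + 1) + s * e < s * (N - S) * (m - s + 1))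
    (w : Fin N → Option (Fin m → F)) :
    ∃ B : Fin s → F[X], B ≠ 0 ∧ ∀ f f' : F[X], f.natDegree ≤ e → f'.natDegree ≤ e →
      L.IsConsistent S A w f → L.IsConsistent S A w f' → f - f' ∈ foldedKernel α B e := by
  classical
  -- The number of windows of `s` consecutive points in a block of `m`.
  set W := m - s + 1 with hW
  let I : Finset (Fin N) := Finset.univ.filter fun i => (w i).isSome
  let pos : Fin W → Fin s → Fin m := fun j l => ⟨j + l, by omega⟩
  let st : Fin W → Fin m := fun j => ⟨j, by omega⟩
  have hpts : ∀ i j l, L.pts i (pos j l) = α ^ (l : ℕ) * L.pts i (st j) := by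
    intro i j l
    rw [hL.2, hL.2, ← pow_add]
    congr 1
    simp only [pos, st]
    ring
  -- The least `d` for which the interpolation count succeeds; truncated subtraction gives `0` if
  -- `e` exceeds the number of constraints.
  set d := (I.card * W - e) / (s + 1) with hd
  have hd1 : I.card * W < (d + 1) * (s + 1) + e := by
    have := Nat.lt_div_mul_add (a := I.card * W - e) (b := s + 1) (by omega)
    rw [← hd] at this
    rw [add_mul]
    omega
  obtain ⟨A₀, B, hne, hA₀, hB, hint⟩ := exists_interpolating_relation
    (κ := I × Fin W) (fun c => L.pts c.1 (st c.2))
    (fun c l => ((w c.1).getD 0) (pos c.2 l)) d e (by simpa using hd1)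
  have hroot : ∀ f : F[X], f.natDegree ≤ e → L.IsConsistent S A w f →
      A₀ + ∑ l, B l * f.comp (C (α ^ (l : ℕ)) * X) = 0 := by
    intro f hf hw
    obtain ⟨G, hG1, hG2, hG⟩ := hw.exists_agree_answers
    have hGI : ∀ i ∈ G, i ∈ I := fun i hi => by simp [I, hG i hi]
    have hGle : G.card ≤ I.card := Finset.card_le_card hGI
    have hkey : d + e < G.card * W := by
      -- The two bounds on `G` are weighted `s : 1` because `(s + 1)(d + e)` is at most `|I| W + s
      -- e` in the main case.
      have h1 : s * (N - S) + I.card ≤ (s + 1) * G.card + (s + 1) * A := by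
        have : s * (N - S) ≤ s * (A + G.card) := Nat.mul_le_mul_left s (by omega)
        have h2 : I.card ≤ G.card + A := hG2
        nlinarith
      have h2 : s * (N - S) * W + I.card * W ≤ (s + 1) * (G.card * W) + A * (s + 1) * W := by
        have := Nat.mul_le_mul_right W h1
        nlinarith
      have h3 : G.card * W ≤ I.card * W := Nat.mul_le_mul_right W hGle
      have h4 : d * (s + 1) ≤ I.card * W - e := Nat.div_mul_le_self _ _
      rcases le_total e (I.card * W) with h5 | h5
      · have h6 : d * (s + 1) + e ≤ I.card * W := by omega
        by_contra hcon
        push Not at hcon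
        have := Nat.mul_le_mul_left (s + 1) hcon
        nlinarith
      -- This case contradicts `H`, since `|G| ≤ |I|`.
      · nlinarith
    refine eq_zero_of_natDegree_lt_card_of_eval_eq_zero _
      (f := fun p : G × Fin W => L.pts p.1 (st p.2)) ?_ ?_ ?_
    · intro p p' hp
      have := @L.pts_injective (p.1.1, st p.2) (p'.1.1, st p'.2) hp
      simp only [Prod.mk.injEq, st, Fin.mk.injEq] at this
      exact Prod.ext (Subtype.ext this.1) (Fin.ext this.2)
    · intro p
      have := hint (⟨p.1, hGI _ p.1.2⟩, p.2)
      simp only [hG _ p.1.2, Option.getD_some, hpts] at this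
      simpa [eval_finsetSum] using this
    · rw [Fintype.card_prod, Fintype.card_fin, Fintype.card_coe]
      refine lt_of_le_of_lt (natDegree_add_le_of_degree_le hA₀ ?_) hkey
      refine natDegree_sum_le_of_forall_le _ _ fun l _ => ?_
      refine natDegree_mul_le_of_le (hB l) (natDegree_comp_le.trans ?_)
      calc f.natDegree * (C (α ^ (l : ℕ)) * X : F[X]).natDegree ≤ e * 1 :=
            Nat.mul_le_mul hf (natDegree_C_mul_le _ _ |>.trans natDegree_X_le)
        _ = e := mul_one e
  by_cases hex : ∃ f : F[X], f.natDegree ≤ e ∧ L.IsConsistent S A w f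
  · obtain ⟨f₀, hf₀, hw₀⟩ := hex
    refine ⟨B, ?_, fun f f' hf hf' hw hw' => ?_⟩
    · rintro rfl
      have := hroot f₀ hf₀ hw₀
      simp at this
      simp [this] at hne
    · rw [mem_foldedKernel]
      refine ⟨natDegree_sub_le_of_le hf hf' |>.trans (by simp), ?_⟩
      have h1 := hroot f hf hw
      have h2 := hroot f' hf' hw'
      simp only [sub_comp, mul_sub, Finset.sum_sub_distrib]
      linear_combination h1 - h2
  -- Without a consistent polynomial any nonzero `B` serves.
  · refine ⟨fun _ => 1, fun h => one_ne_zero (congrFun h ⟨0, hs⟩), fun f f' hf _ hw => ?_⟩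
    exact absurd ⟨f, hf, hw⟩ hex

/-- The field is large enough: `H` forces `e < (N - S)(m - s + 1) ≤ Nm ≤ |F| - 1 = orderOf α`. This
is used both for the dimension bound and to separate the kernel by evaluations on all of `F`. -/
theorem flcc_isResilientSecure [Fintype F] (L : LagrangeScheme F N K T m) {α : F}
    (hL : L.IsFolded α) {S A D s : ℕ} (hs : 1 ≤ s) (hsm : s ≤ m)
    (H : A * (s + 1) * (m - s + 1) + s * (D * (m * (K + T) - 1)) <
      s * (N - S) * (m - s + 1)) :
    L.IsResilientSecure S A D (s - 1) := by
  classical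
  refine L.isResilientSecure_of_separating fun w => ?_
  set e := D * (m * (K + T) - 1)
  have hα : α ≠ 0 := by
    rintro rfl
    have h1 := hL.1
    rw [orderOf_zero] at h1
    have := Fintype.one_lt_card (α := F)
    omega
  have hNm : N * m ≤ Fintype.card F - 1 := by
    rw [← Fintype.card_units]
    have := Fintype.card_le_of_injective
      (fun p : Fin N × Fin m => Units.mk0 (L.pts p.1 p.2) (by rw [hL.2]; exact pow_ne_zero _ hα))
      (fun p p' hp => L.pts_injective (congrArg Units.val hp))
    simpa using this
  have he : e < N * m := by
    have h1 : s * e < s * ((N - S) * (m - s + 1)) := by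
      rw [← mul_assoc s (N - S)]
      exact (Nat.le_add_left _ _).trans_lt H
    have h2 := Nat.lt_of_mul_lt_mul_left h1
    exact h2.trans_le (Nat.mul_le_mul (by omega) (by omega))
  obtain ⟨B, hB, hker⟩ := L.exists_foldedKernel_of_isConsistent hL hs hsm H w
  obtain ⟨hfd, hdim⟩ := foldedKernel_finrank_le hB (e := e) (γ := α) (by rw [hL.1]; omega)
  obtain ⟨q, hq⟩ := exists_separating_family (fun x : F => leval x) (s - 1) (foldedKernel α B e)
    (by omega) (fun f hf hz => by
      refine eq_zero_of_natDegree_lt_card_of_eval_eq_zero f (f := (id : F → F))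
        Function.injective_id hz ?_
      have := (mem_foldedKernel.1 hf).1
      omega)
  refine ⟨q, fun f f' hf hf' hw hw' hev => ?_⟩
  rw [← sub_eq_zero]
  refine hq _ (hker f f' hf hf' hw hw') fun l => ?_
  rw [leval_apply, eval_sub, hev l, sub_self]

end LagrangeScheme

/-! ### Optimizing the decoding radius -/

section DecodingRadius

variable {m s : ℕ} {r : ℝ}

/-- Splits the loss into the price of a finite order and an amplified rate; it is affine in `r`. -/
theorem one_sub_decodingRadius (hsm : s ≤ m) :
    1 - decodingRadius m r s = 1 / ((s : ℝ) + 1) + r * (m * s / ((s + 1) * ((m : ℝ) - s + 1))) := by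
  have h1 : (s : ℝ) ≤ m := by exact_mod_cast hsm
  have h2 : (m : ℝ) - s + 1 ≠ 0 := by linarith
  have h3 : (s : ℝ) + 1 ≠ 0 := by positivity
  rw [decodingRadius]
  field_simp
  ring

theorem decodingRadius_succ_sub (hsm : s < m) :
    decodingRadius m r (s + 1) - decodingRadius m r s =
      ((m * (1 - r) + 2) * ((m - s) * (m - s + 1)) - m * r * (m + 1) * ((s + 1) * (s + 2))) /
        ((m + 2) * (((s : ℝ) + 1) * (s + 2)) * ((m - s) * (m - s + 1))) := by
  have h1 : (s : ℝ) + 1 ≤ m := by exact_mod_cast hsm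
  have h2 : (m : ℝ) - s + 1 ≠ 0 := by linarith
  have h3 : (s : ℝ) + 1 ≠ 0 := by positivity
  have h4 : (m : ℝ) - s ≠ 0 := by linarith
  have h5 : (s : ℝ) + 2 ≠ 0 := by positivity
  have h6 : (m : ℝ) + 2 ≠ 0 := by positivity
  have h7 : (s : ℝ) + 1 + 1 ≠ 0 := by positivity
  have h8 : (m : ℝ) - (s + 1) + 1 ≠ 0 := by
    intro h
    exact h4 (by linarith)
  rw [decodingRadius, decodingRadius]
  push_cast
  rw [show (m : ℝ) - (s + 1) + 1 = m - s by ring, show (s : ℝ) + 1 + 1 = s + 2 by ring]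
  field_simp
  ring

theorem decodingRadius_le_succ_iff (hsm : s < m) :
    decodingRadius m r s ≤ decodingRadius m r (s + 1) ↔
      m * r * (m + 1) * (((s : ℝ) + 1) * (s + 2)) ≤
        (m * (1 - r) + 2) * (((m : ℝ) - s) * (m - s + 1)) := by
  have h1 : (s : ℝ) + 1 ≤ m := by exact_mod_cast hsm
  have h2 : 0 < (m : ℝ) - s := by linarith
  rw [← sub_nonneg, decodingRadius_succ_sub hsm, le_div_iff₀ (by positivity), zero_mul,
    sub_nonneg]

theorem decodingRadius_succ_le_iff (hsm : s < m) :
    decodingRadius m r (s + 1) ≤ decodingRadius m r s ↔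
      (m * (1 - r) + 2) * (((m : ℝ) - s) * (m - s + 1)) ≤
        m * r * (m + 1) * (((s : ℝ) + 1) * (s + 2)) := by
  have h1 : (s : ℝ) + 1 ≤ m := by exact_mod_cast hsm
  have h2 : 0 < (m : ℝ) - s := by linarith
  rw [← sub_nonpos, decodingRadius_succ_sub hsm, div_le_iff₀ (by positivity), zero_mul,
    sub_nonpos]

/-- At an optimal order the decoding radius does not grow by a step down. -/
theorem IsOptimalOrder.step_down (h : IsOptimalOrder m r s) (hs : 2 ≤ s) :
    m * r * (m + 1) * ((s : ℝ) * (s + 1)) ≤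
      (m * (1 - r) + 2) * (((m : ℝ) - s + 1) * (m - s + 2)) := by
  obtain ⟨s, rfl⟩ : ∃ s', s = s' + 1 := ⟨s - 1, by omega⟩
  have h1 := (decodingRadius_le_succ_iff (by have := h.1.2; omega)).1
    (h.2 s (by omega) (by have := h.1.2; omega))
  push_cast
  convert h1 using 2 <;> ring

/-- At an optimal order the decoding radius does not grow by a step up. -/
theorem IsOptimalOrder.step_up (h : IsOptimalOrder m r s) (hs : s < m) :
    (m * (1 - r) + 2) * (((m : ℝ) - s) * (m - s + 1)) ≤
      m * r * (m + 1) * (((s : ℝ) + 1) * (s + 2)) :=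
  (decodingRadius_succ_le_iff hs).1 (h.2 (s + 1) (by omega) hs)

/-- In `step_down`, `(m-s+1)(m-s+2) ≤ m(m+1)` lets the factor `m(m+1)` cancel, leaving `r s(s+1) ≤
m(1-r) + 2`. -/
theorem IsOptimalOrder.sq_mul_le (h : IsOptimalOrder m r s) (hr : 0 < r) (hr1 : r ≤ 1) :
    (s : ℝ) ^ 2 * r ≤ 3 * m := by
  have hs1 : (1 : ℝ) ≤ s := by exact_mod_cast h.1.1
  have hsm : (s : ℝ) ≤ m := by exact_mod_cast h.1.2
  have hm : (1 : ℝ) ≤ m := hs1.trans hsm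
  rcases h.1.1.eq_or_lt with h1 | h1
  · rw [← h1]
    push_cast
    linarith
  have h2 := h.step_down h1
  have hb : 0 ≤ m * (1 - r) + 2 := by nlinarith
  have h3 : ((m : ℝ) - s + 1) * (m - s + 2) ≤ m * (m + 1) :=
    mul_le_mul (by linarith) (by linarith) (by linarith) (by linarith)
  have h4 := h2.trans (mul_le_mul_of_nonneg_left h3 hb)
  have h5 : r * ((s : ℝ) * (s + 1)) ≤ m * (1 - r) + 2 := by
    refine le_of_mul_le_mul_right ?_ (show (0 : ℝ) < m * (m + 1) by positivity)
    linarith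
  nlinarith

theorem IsOptimalOrder.le_sqrt (h : IsOptimalOrder m r s) (hr : 0 < r) (hr1 : r ≤ 1) :
    (s : ℝ) ≤ 13 * Real.sqrt (m / r) := by
  have h1 := h.sq_mul_le hr hr1
  have h2 : (s : ℝ) ^ 2 ≤ 13 ^ 2 * (m / r) := by
    rw [← le_div_iff₀ hr] at h1
    refine h1.trans ?_
    rw [mul_div_assoc]
    exact mul_le_mul_of_nonneg_right (by norm_num) (by positivity)
  refine Real.le_sqrt_of_sq_le h2 |>.trans ?_
  rw [Real.sqrt_mul (by norm_num), Real.sqrt_sq (by norm_num)]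

/-- With `x`, `y` the two radicals, `y² - x² = (m+2)(mr-1)`, so the factor `y - x` cancels and the
singularity at `mr = 1` disappears. -/
theorem sTilde_add_one (hr : 0 < r) (hr1 : r ≤ 1) (hm : 1 ≤ m) (hmr : (m : ℝ) * r ≠ 1) :
    sTilde m r + 1 = (m + 2) * Real.sqrt (m * (1 - r) + 2) /
      (Real.sqrt (m * (1 - r) + 2) + Real.sqrt (m * r * (m + 1))) := by
  have hm' : (1 : ℝ) ≤ m := by exact_mod_cast hm
  have hb1 : 0 < m * (1 - r) + 2 := by nlinarith
  have hb2 : 0 < m * r * (m + 1) := by positivity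
  have hx := Real.sqrt_pos.2 hb1
  have hy := Real.sqrt_pos.2 hb2
  have hx2 := Real.sq_sqrt hb1.le
  have hy2 := Real.sq_sqrt hb2.le
  rw [sTilde, show (m : ℝ) * (m + 1) * (m * (1 - r) + 2) * r =
    (m * (1 - r) + 2) * (m * r * (m + 1)) by ring, Real.sqrt_mul hb1.le]
  set x := Real.sqrt (m * (1 - r) + 2)
  set y := Real.sqrt (m * r * (m + 1))
  have h0 : (m : ℝ) * r - 1 ≠ 0 := sub_ne_zero.2 hmr
  rw [div_add_one h0, div_eq_div_iff h0 (by positivity)]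
  have h1 : x * y - (m + 1) + (m * r - 1) = x * (y - x) := by linear_combination hx2
  rw [h1]
  linear_combination x * hy2 - x * hx2

/-- Weakening the products of consecutive factors in `step_down` and `step_up` to squares and taking
roots gives `s - 1 < s̃ ≤ s + 1`. -/
theorem IsOptimalOrder.hasClosedForm (h : IsOptimalOrder m r s) (hr : 0 < r) (hr1 : r ≤ 1) :
    HasClosedForm m r s := by
  intro hmr
  have hs1 : (1 : ℝ) ≤ s := by exact_mod_cast h.1.1
  have hsm : (s : ℝ) ≤ m := by exact_mod_cast h.1.2
  have hm : (1 : ℝ) ≤ m := hs1.trans hsm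
  have hform := sTilde_add_one hr hr1 (h.1.1.trans h.1.2) hmr
  have hb1 : 0 < m * (1 - r) + 2 := by nlinarith
  have hb2 : 0 < m * r * (m + 1) := by positivity
  have hx := Real.sqrt_pos.2 hb1
  have hy := Real.sqrt_pos.2 hb2
  have hx2 := Real.sq_sqrt hb1.le
  have hy2 := Real.sq_sqrt hb2.le
  set x := Real.sqrt (m * (1 - r) + 2)
  set y := Real.sqrt (m * r * (m + 1))
  have hlow : (s : ℝ) - 1 < sTilde m r := by
    suffices H : (s : ℝ) < (m + 2) * x / (x + y) by linarith
    rw [lt_div_iff₀ (by positivity)]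
    suffices H : s * y < ((m : ℝ) - s + 2) * x by linarith
    refine lt_of_pow_lt_pow_left₀ 2 (mul_nonneg (by linarith) hx.le) ?_
    rw [mul_pow, mul_pow, hx2, hy2]
    rcases h.1.1.eq_or_lt with h1 | h1
    · rw [← h1]
      push_cast
      have h2 : m * r ≤ m := by nlinarith
      have h3 : 0 ≤ m * (1 - r) := by nlinarith
      nlinarith
    · have h2 := h.step_down h1
      nlinarith
  have hup : sTilde m r ≤ s + 1 := by
    suffices H : (m + 2) * x / (x + y) ≤ (s : ℝ) + 2 by linarith
    rw [div_le_iff₀ (by positivity)]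
    suffices H : ((m : ℝ) - s) * x ≤ (s + 2) * y by linarith
    refine le_of_sq_le_sq ?_ (by positivity)
    rw [mul_pow, mul_pow, hx2, hy2]
    rcases h.1.2.eq_or_lt with h1 | h1
    · rw [h1, sub_self, zero_pow two_ne_zero, zero_mul]
      positivity
    · have h2 := h.step_up h1
      nlinarith
  have h1 : ⌈sTilde m r⌉ ≤ (s : ℤ) + 1 := Int.ceil_le.2 (by exact_mod_cast hup)
  have h2 : (s : ℤ) - 1 < ⌈sTilde m r⌉ := Int.lt_ceil.2 (by exact_mod_cast hlow)
  omega

/-- The order `⌈√m⌉ - 1` yields the decoding radius `1 - r - 1 / √m` for all rates `r`. -/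
theorem IsOptimalOrder.le_decodingRadius (h : IsOptimalOrder m r s) (hr : 0 ≤ r) (hr1 : r ≤ 1)
    (hm : 2 ≤ m) : 1 - r - 1 / Real.sqrt m ≤ decodingRadius m r s := by
  have hm' : (2 : ℝ) ≤ m := by exact_mod_cast hm
  have hx0 : 0 ≤ (m : ℝ) := by linarith
  have hx2 := Real.sq_sqrt hx0
  have hx1 : 1 < Real.sqrt m := by
    rw [Real.lt_sqrt (by norm_num)]
    linarith
  set x := Real.sqrt m
  obtain ⟨t, ht⟩ : ∃ t, ⌈x⌉₊ = t + 2 := by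
    have : 1 < ⌈x⌉₊ := Nat.lt_ceil.2 (by exact_mod_cast hx1)
    exact ⟨⌈x⌉₊ - 2, by omega⟩
  have hp1 : x ≤ (t : ℝ) + 2 := by
    have := Nat.le_ceil x
    rw [ht] at this
    exact_mod_cast this
  have hp2 : (t : ℝ) + 1 < x := by
    have := Nat.ceil_lt_add_one (show 0 ≤ x by linarith)
    rw [ht] at this
    push_cast at this
    linarith
  have htm : t + 1 ≤ m := by
    have : (t : ℝ) + 1 ≤ m := by nlinarith
    exact_mod_cast this
  refine le_trans ?_ (h.2 (t + 1) (by omega) htm)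
  have h1 := one_sub_decodingRadius (r := r) htm
  push_cast at h1
  set p : ℝ := (t : ℝ) + 2 with hp
  have hw : 0 < x ^ 2 + 2 - p := by nlinarith
  rw [show (t : ℝ) + 1 + 1 = p by rw [hp]; ring, show (t : ℝ) + 1 = p - 1 by rw [hp]; ring,
    ← hx2, show x ^ 2 - (p - 1) + 1 = x ^ 2 + 2 - p by ring] at h1
  have hppos : 0 < p := by linarith
  -- As the loss is affine in `r`, it suffices to bound it by `r + 1/x` at `r = 0` and `r = 1`.
  have hr0 : 1 / p ≤ 1 / x := one_div_le_one_div_of_le (by linarith) hp1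
  have hrr : 1 / p + x ^ 2 * (p - 1) / (p * (x ^ 2 + 2 - p)) ≤ 1 + 1 / x := by
    have hδ : 0 ≤ (2 + x - p) * p * (x + 1) - 2 * x := by
      have h2 : x ≤ (2 + x - p) * p := by nlinarith
      nlinarith
    rw [← sub_nonneg]
    have : 1 + 1 / x - (1 / p + x ^ 2 * (p - 1) / (p * (x ^ 2 + 2 - p))) =
        ((2 + x - p) * p * (x + 1) - 2 * x) / (x * p * (x ^ 2 + 2 - p)) := by
      field_simp
      ring
    rw [this]
    positivity
  nlinarith

/-- The order `⌈2/ε⌉ - 1` costs at most `ε/2`, and the size of `m` keeps the excess `r p/(m+2-p)`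
below `ε/2`. The bound `r₀` allows `m` to be fixed before `r`, which depends on `m`. -/
theorem le_decodingRadius_of_large {ε r₀ : ℝ} (h : IsOptimalOrder m r s) (hε : 0 < ε) (hε1 : ε < 1)
    (hr : 0 ≤ r) (hrr : r ≤ r₀) (hm : 8 * r₀ / ε ^ 2 + 4 / ε ≤ m) :
    1 - r - ε ≤ decodingRadius m r s := by
  have hi : 1 < 1 / ε := by rw [lt_div_iff₀ hε]; linarith
  obtain ⟨t, ht⟩ : ∃ t, ⌈2 / ε⌉₊ = t + 2 := by
    have : 1 < ⌈2 / ε⌉₊ := Nat.lt_ceil.2 (by rw [← mul_one_div]; push_cast; linarith)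
    exact ⟨⌈2 / ε⌉₊ - 2, by omega⟩
  have hp1 : 2 * (1 / ε) ≤ (t : ℝ) + 2 := by
    have := Nat.le_ceil (2 / ε)
    rw [ht, ← mul_one_div] at this
    exact_mod_cast this
  have hp2 : (t : ℝ) + 1 < 2 * (1 / ε) := by
    have := Nat.ceil_lt_add_one (show 0 ≤ 2 / ε by positivity)
    rw [ht, ← mul_one_div] at this
    push_cast at this
    linarith
  have hm' : 8 * r₀ * (1 / ε) ^ 2 + 4 * (1 / ε) ≤ m := by
    convert hm using 2 <;> field_simp
  have hεi : ε * (1 / ε) = 1 := mul_one_div_cancel hε.ne'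
  set i := 1 / ε
  have hr₀ : 0 ≤ r₀ := hr.trans hrr
  have htm : t + 1 ≤ m := by
    have h0 : 0 ≤ 8 * r₀ * i ^ 2 := by positivity
    have : (t : ℝ) + 1 ≤ m := by linarith
    exact_mod_cast this
  refine le_trans ?_ (h.2 (t + 1) (by omega) htm)
  have h1 := one_sub_decodingRadius (r := r) htm
  push_cast at h1
  set p : ℝ := (t : ℝ) + 2 with hp
  rw [show (t : ℝ) + 1 + 1 = p by rw [hp]; ring, show (t : ℝ) + 1 = p - 1 by rw [hp]; ring,
    show (m : ℝ) - (p - 1) + 1 = m + 2 - p by ring] at h1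
  have hp3 : p ≤ 3 * i := by linarith
  have hw : 8 * r * i ^ 2 ≤ m + 2 - p := by
    have : 8 * r * i ^ 2 ≤ 8 * r₀ * i ^ 2 := by gcongr
    linarith
  have hw0 : 0 < m + 2 - p := by
    have h0 : 0 ≤ 8 * r₀ * i ^ 2 := by positivity
    linarith
  have hppos : 0 < p := by linarith
  have hpε : 1 / p ≤ ε / 2 := by
    rw [div_le_div_iff₀ hppos (by norm_num)]
    nlinarith
  have hsecond : m * (p - 1) / (p * (m + 2 - p)) ≤ 1 + p / (m + 2 - p) := by
    rw [← sub_nonneg]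
    have : 1 + p / (m + 2 - p) - m * (p - 1) / (p * (m + 2 - p)) =
        (m + 2 * p) / (p * (m + 2 - p)) := by
      field_simp
      ring
    rw [this]
    positivity
  have hthird : r * (p / (m + 2 - p)) ≤ ε / 2 := by
    rw [← mul_div_assoc, div_le_div_iff₀ hw0 (by norm_num)]
    have h2 : ε * (8 * r * i ^ 2) ≤ ε * (m + 2 - p) := mul_le_mul_of_nonneg_left hw hε.le
    have h3 : ε * (8 * r * i ^ 2) = 8 * r * i := by linear_combination 8 * r * i * hεi
    have h4 : r * p ≤ r * (3 * i) := mul_le_mul_of_nonneg_left hp3 hr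
    have h5 : 0 ≤ r * i := mul_nonneg hr (by linarith)
    nlinarith
  have := mul_le_mul_of_nonneg_left hsecond hr
  rw [mul_add, mul_one] at this
  linarith

end DecodingRadius

/-! ### Adversary counts, rates and the choice of `m` -/

theorem le_flccAdversaries_iff {ε : ℝ} {N S K T D A : ℕ} (hε1 : ε < 1) :
    (A : ℤ) ≤ flccAdversaries ε N S K T D ↔
      (S : ℝ) + ((A : ℝ) + ((K : ℝ) + T) * D + 1) / (1 - ε) ≤ N := by
  rw [flccAdversaries, Int.le_floor, ← le_sub_iff_add_le', div_le_iff₀ (by linarith), Int.cast_natCast]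
  constructor <;> intro h <;> linarith

theorem modifiedRate_mul {N S K T D m : ℕ} (hNS : (0 : ℝ) < (N : ℝ) - S) :
    ((N : ℝ) - S) * modifiedRate N S K T D m = ((K : ℝ) + T - 1 / m) * D + 1 :=
  mul_div_cancel₀ _ hNS.ne'

theorem modifiedRate_pos {N S K T D m : ℕ} (hNS : (0 : ℝ) < (N : ℝ) - S) (hK : 1 ≤ K)
    (hm : 1 ≤ m) : 0 < modifiedRate N S K T D m := by
  have hK' : (1 : ℝ) ≤ K := by exact_mod_cast hK
  have hm' : 1 / (m : ℝ) ≤ 1 := by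
    rw [div_le_one (by positivity)]
    exact_mod_cast hm
  have h0 : (0 : ℝ) ≤ K + T - 1 / m := by
    have : (0 : ℝ) ≤ T := by positivity
    linarith
  exact div_pos (by positivity) hNS

/-- A decoding radius that covers `A` adversaries makes every FLCC resilient, secure and private. -/
theorem flccTolerates_of_le_decodingRadius {N S K T D m A s : ℕ}
    (hNS : (0 : ℝ) < (N : ℝ) - S) (hK : 1 ≤ K) (hs : 1 ≤ s) (hsm : s ≤ m)
    (hA : (A : ℝ) ≤ ((N : ℝ) - S) * decodingRadius m (modifiedRate N S K T D m) s) :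
    FLCCTolerates.{u} N S K T D m A (s - 1) := by
  intro F _ _ α L hL
  refine ⟨L.flcc_isResilientSecure hL hs hsm ?_, L.isPrivate⟩
  have hSN : S ≤ N := by
    have : (S : ℝ) ≤ N := by linarith
    exact_mod_cast this
  have hKT : 1 ≤ m * (K + T) := Nat.mul_pos (by omega) (by omega)
  have hs' : (1 : ℝ) ≤ s := by exact_mod_cast hs
  have hsm' : (s : ℝ) ≤ m := by exact_mod_cast hsm
  have hw : 0 < (m : ℝ) - s + 1 := by linarith
  have hm : (m : ℝ) ≠ 0 := by linarith
  rw [← Nat.cast_lt (α := ℝ)]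
  push_cast [Nat.cast_sub hSN, Nat.cast_sub hsm, Nat.cast_sub hKT]
  have hrate := modifiedRate_mul (K := K) (T := T) (D := D) (m := m) hNS
  have he : (D : ℝ) * (m * (K + T) - 1) =
      m * (((N : ℝ) - S) * modifiedRate N S K T D m) - m := by
    rw [hrate]
    field_simp
    ring
  set ρ := modifiedRate N S K T D m
  have hrad : decodingRadius m ρ s * ((s + 1) * ((m : ℝ) - s + 1)) = s * (m - s + 1 - m * ρ) := by
    rw [decodingRadius]
    field_simp
  have h1 := mul_le_mul_of_nonneg_right hA
    (show 0 ≤ ((s : ℝ) + 1) * ((m : ℝ) - s + 1) by positivity)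
  rw [mul_assoc ((N : ℝ) - S), hrad] at h1
  rw [he]
  -- Strictness comes from this surplus: `m(N - S)ρ` equals `e + m`, not `e`.
  have h2 : 0 < (s : ℝ) * m := by nlinarith
  linarith

/-- The rates of FLCC are at most `((K + T) D + 1) / (N - S) ≤ 1 - ε`, for all folding parameters. -/
theorem rate_bounds {ε : ℝ} {N S K T D A : ℕ} (hε1 : ε < 1)
    (hA : (A : ℤ) = flccAdversaries ε N S K T D) :
    (0 : ℝ) < (N : ℝ) - S ∧ (((K : ℝ) + T) * D + 1) / ((N : ℝ) - S) ≤ 1 - ε ∧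
      ∀ m, modifiedRate N S K T D m ≤ (((K : ℝ) + T) * D + 1) / ((N : ℝ) - S) ∧
        (A : ℝ) ≤ ((N : ℝ) - S) * (1 - modifiedRate N S K T D m - ε) := by
  have h1 := (le_flccAdversaries_iff hε1).1 hA.le
  rw [← le_sub_iff_add_le', div_le_iff₀ (by linarith)] at h1
  have h2 : (0 : ℝ) < ((K : ℝ) + T) * D + 1 := by positivity
  have h3 : (0 : ℝ) ≤ A := by positivity
  have hNS : (0 : ℝ) < (N : ℝ) - S := by
    by_contra hcon
    push Not at hcon
    nlinarith
  refine ⟨hNS, ?_, fun m => ?_⟩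
  · rw [div_le_iff₀ hNS]
    linarith
  · have h4 : ((K : ℝ) + T - 1 / m) * D + 1 ≤ ((K : ℝ) + T) * D + 1 := by
      have : (0 : ℝ) ≤ 1 / m * D := by positivity
      linarith
    refine ⟨div_le_div_of_nonneg_right h4 hNS.le, ?_⟩
    have := modifiedRate_mul (K := K) (T := T) (D := D) (m := m) hNS
    rw [mul_sub, mul_sub, this]
    linarith

/-- Bounds the rate below independently of `m`: as `K ≥ 1` and `m ≥ 2`, the term `1/m` removes at
most half of `K + T`. -/
theorem half_rate_le_modifiedRate {N S K T D m : ℕ} (hNS : (0 : ℝ) < (N : ℝ) - S) (hK : 1 ≤ K)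
    (hm : 2 ≤ m) :
    (((K : ℝ) + T) * D + 1) / ((N : ℝ) - S) ≤ 2 * modifiedRate N S K T D m := by
  rw [modifiedRate, ← mul_div_assoc]
  refine div_le_div_of_nonneg_right ?_ hNS.le
  have hK' : (1 : ℝ) ≤ K := by exact_mod_cast hK
  have hm' : 1 / (m : ℝ) ≤ 1 / 2 :=
    one_div_le_one_div_of_le (by norm_num) (by exact_mod_cast hm)
  have hT : (0 : ℝ) ≤ T := by positivity
  have hD : (0 : ℝ) ≤ D := by positivity
  have : (0 : ℝ) ≤ (K + T - 2 * (1 / (m : ℝ))) * D := mul_nonneg (by linarith) hD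
  linarith

theorem exists_foldingParameter {ε : ℝ} {N S K T D A : ℕ} (hε : 0 < ε) (hε1 : ε < 1) (hK : 1 ≤ K)
    (hA : (A : ℤ) = flccAdversaries ε N S K T D) :
    ∃ m : ℕ, 1 ≤ m ∧ (m : ℝ) ≤ 13 / ε ^ 2 ∧
      ∀ s : ℕ, IsOptimalOrder m (modifiedRate N S K T D m) s →
        (s : ℝ) ≤ 13 / ε ∧ HasClosedForm m (modifiedRate N S K T D m) s ∧
          FLCCTolerates.{u} N S K T D m A (s - 1) := by
  obtain ⟨hNS, hr₀, hrate⟩ := rate_bounds hε1 hA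
  set r₀ := (((K : ℝ) + T) * D + 1) / ((N : ℝ) - S)
  have hr₀pos : 0 < r₀ := div_pos (by positivity) hNS
  have hi : 1 < 1 / ε := by rw [lt_div_iff₀ hε]; linarith
  set m := ⌈8 * r₀ / ε ^ 2 + 4 / ε⌉₊ with hmdef
  have hmle : 8 * r₀ / ε ^ 2 + 4 / ε ≤ m := Nat.le_ceil _
  have hmlt : (m : ℝ) < 8 * r₀ / ε ^ 2 + 4 / ε + 1 := Nat.ceil_lt_add_one (by positivity)
  have hεi : ε * (1 / ε) = 1 := mul_one_div_cancel hε.ne'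
  rw [show 8 * r₀ / ε ^ 2 + 4 / ε = 8 * r₀ * (1 / ε) ^ 2 + 4 * (1 / ε) by field_simp] at hmlt
  have hm2 : 2 ≤ m := by
    have h1 : (0 : ℝ) ≤ 8 * r₀ / ε ^ 2 := by positivity
    have h2 : 4 / ε = 4 * (1 / ε) := by ring
    have : (2 : ℝ) ≤ m := by linarith
    exact_mod_cast this
  refine ⟨m, by omega, ?_, fun s h => ?_⟩
  · rw [show 13 / ε ^ 2 = 13 * (1 / ε) ^ 2 by field_simp]
    have h1 : r₀ * (1 / ε) ^ 2 ≤ 1 * (1 / ε) ^ 2 :=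
      mul_le_mul_of_nonneg_right (by linarith) (by positivity)
    nlinarith
  obtain ⟨hrr, hAr⟩ := hrate m
  have hrpos := modifiedRate_pos (T := T) (D := D) hNS hK (show 1 ≤ m by omega)
  have hhalf := half_rate_le_modifiedRate (T := T) (D := D) hNS hK hm2
  have hr1 : modifiedRate N S K T D m ≤ 1 := by linarith
  refine ⟨?_, h.hasClosedForm hrpos hr1, flccTolerates_of_le_decodingRadius hNS hK h.1.1 h.1.2
    (hAr.trans (mul_le_mul_of_nonneg_left
      (le_decodingRadius_of_large h hε hε1 hrpos.le hrr hmle) hNS.le))⟩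
  rw [← mul_one_div]
  -- If `r₀ ≤ ε`, then `s ≤ m ≤ (8 + 4 + 1)/ε`. Otherwise `1/ε ≤ r₀/ε²`, so `m ≤ 13 r₀/ε²`, and `r₀`
  -- cancels in `s² r₀ ≤ 6m`.
  rcases le_total r₀ ε with hsmall | hlarge
  · have h1 : (s : ℝ) ≤ m := by exact_mod_cast h.1.2
    have h2 : r₀ * (1 / ε) ^ 2 ≤ ε * (1 / ε) ^ 2 :=
      mul_le_mul_of_nonneg_right hsmall (by positivity)
    have h3 : ε * (1 / ε) ^ 2 = 1 / ε := by rw [sq, ← mul_assoc, hεi, one_mul]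
    linarith
  · have h1 := h.sq_mul_le hrpos hr1
    have h2 : 1 / ε ≤ r₀ * (1 / ε) ^ 2 := by
      have : ε * (1 / ε) ^ 2 ≤ r₀ * (1 / ε) ^ 2 :=
        mul_le_mul_of_nonneg_right hlarge (by positivity)
      rwa [sq, ← mul_assoc, hεi, one_mul, ← sq] at this
    have h3 : (s : ℝ) ^ 2 * r₀ ≤ (13 * (1 / ε)) ^ 2 * r₀ := by
      have h4 : (s : ℝ) ^ 2 * r₀ ≤ (s : ℝ) ^ 2 * (2 * modifiedRate N S K T D m) :=
        mul_le_mul_of_nonneg_left hhalf (by positivity)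
      nlinarith
    exact le_of_sq_le_sq (le_of_mul_le_mul_right h3 hr₀pos) (by positivity)

theorem flcc_of_one_div_sq_le {ε : ℝ} {N S K T D A m s : ℕ} (hε : 0 < ε) (hε1 : ε < 1)
    (hK : 1 ≤ K) (hA : (A : ℤ) = flccAdversaries ε N S K T D) (hm : 1 / ε ^ 2 ≤ (m : ℝ))
    (h : IsOptimalOrder m (modifiedRate N S K T D m) s) :
    (s : ℝ) ≤ 13 * Real.sqrt (m / modifiedRate N S K T D m) ∧
      HasClosedForm m (modifiedRate N S K T D m) s ∧
      FLCCTolerates.{u} N S K T D m A (s - 1) := by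
  obtain ⟨hNS, hr₀, hrate⟩ := rate_bounds hε1 hA
  obtain ⟨hrr, hAr⟩ := hrate m
  have hm2 : 2 ≤ m := by
    have h1 : 1 < 1 / ε ^ 2 := by
      rw [lt_div_iff₀ (by positivity)]
      nlinarith
    have : (1 : ℝ) < m := h1.trans_le hm
    exact_mod_cast this
  have hrpos := modifiedRate_pos (T := T) (D := D) hNS hK (show 1 ≤ m by omega)
  have hr1 : modifiedRate N S K T D m ≤ 1 := by linarith
  have hsqrt : 1 / Real.sqrt m ≤ ε := by
    have h1 : 1 / ε ≤ Real.sqrt m := Real.le_sqrt_of_sq_le (by rwa [div_pow, one_pow])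
    rw [div_le_iff₀ hε] at h1
    rw [div_le_iff₀ (Real.sqrt_pos.2 (by positivity))]
    linarith
  refine ⟨h.le_sqrt hrpos hr1, h.hasClosedForm hrpos hr1,
    flccTolerates_of_le_decodingRadius hNS hK h.1.1 h.1.2
      (hAr.trans (mul_le_mul_of_nonneg_left ?_ hNS.le))⟩
  have := h.le_decodingRadius hrpos.le hr1 hm2
  linarith

theorem mainTheorem4 :
    -- absolute constants in `m = O(1/ε²)` and `s* = O(1/ε)`
    (∃ C : ℝ, 0 < C ∧
      ∀ (ε : ℝ) (N S K T D A : ℕ), 0 < ε → ε < 1 → 1 ≤ K →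
        (A : ℤ) = flccAdversaries ε N S K T D →
        (∃ m : ℕ, 1 ≤ m ∧ (m : ℝ) ≤ C / ε ^ 2 ∧
          ∀ s : ℕ, IsOptimalOrder m (modifiedRate N S K T D m) s →
            (s : ℝ) ≤ C / ε ∧
            HasClosedForm m (modifiedRate N S K T D m) s ∧
            FLCCTolerates.{u} N S K T D m A (s - 1)) ∧
        -- every `m ≥ 1/ε²`, in particular a choice of `m` that depends on `ε` alone
        (∀ m : ℕ, 1 / ε ^ 2 ≤ (m : ℝ) →
          ∀ s : ℕ, IsOptimalOrder m (modifiedRate N S K T D m) s →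
            (s : ℝ) ≤ C * Real.sqrt (m / modifiedRate N S K T D m) ∧
            HasClosedForm m (modifiedRate N S K T D m) s ∧
            FLCCTolerates.{u} N S K T D m A (s - 1))) ∧
    -- the number of workers that FLCC needs for `A` adversaries and `S` stragglers
    (∀ (ε : ℝ) (N S K T D A : ℕ), 0 < ε → ε < 1 →
      ((A : ℤ) ≤ flccAdversaries ε N S K T D ↔
        (S : ℝ) + ((A : ℝ) + ((K : ℝ) + T) * D + 1) / (1 - ε) ≤ N)) ∧
    -- the number of workers that LCC needs for `A` adversaries and `S` stragglers
    (∀ (N S K T D A : ℕ), 1 ≤ K → 1 ≤ D →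
      ∀ (F : Type u) [Field F] [Fintype F] (L : LagrangeScheme F N K T 1),
        (L.IsResilientSecure S A D 0 ∧ L.IsPrivate) ↔ (K + T - 1) * D + S + 2 * A + 1 ≤ N) := by
  refine ⟨⟨13, by norm_num, fun ε N S K T D A hε hε1 hK hA =>
    ⟨exists_foldingParameter hε hε1 hK hA, fun m hm s h => flcc_of_one_div_sq_le hε hε1 hK hA hm h⟩⟩,
    fun ε N S K T D A _ hε1 => le_flccAdversaries_iff hε1, fun N S K T D A hK hD F _ _ L => ?_⟩
  exact ⟨fun h => L.lcc_le_card_of_isResilientSecure hK hD h.1,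
    fun h => ⟨L.lcc_isResilientSecure h, L.isPrivate⟩⟩
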